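/- Let $p_i>0$ ($i=0,1,2,\dots$) with $\sum_{i\ge 0}p_i=1$, and let $\xi_1,\xi_2,\dots$ be independent identically distributed random variables with $\mathbf P(\xi_n=i)=p_i$ for all $i\ge 0$. Put $\bar\xi_n=\max_{1\le i\le n}\xi_i$ for $n\ge 1$, $$R(n)=-\ln\Big(\sum_{i\ge n}p_i\Big)\quad(n\ge 0),\qquad r(n)=R(n)-R(n-1)\quad(n\ge 1),$$ $$a_n=\max\Big\{k\ge 0:\ \sum_{i\ge k}p_i\ge \frac1n\Big\}\quad(n\ge 1).$$ Assume that $r$ is a monotone function of $n\ge 1$ and that $r(n)\to\infty$ as $n\to\infty$. Then: (i) for $l\in\{0,1\}$, $\ \mathbf P(\bar\xi_n=a_n+l \text{ for infinitely many } n)=1$; (ii) for every integer $l>1$, the probability $\mathbf P(\bar\xi_n=a_n+l\text{ for infinitely many } n)$ equals $0$ if the series $\sum_{k\ge1}\exp(-(l-1)\,r(k))$ converges, and equals $1$ if it diverges. -/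

import Mathlib

open Filter Topology MeasureTheory ProbabilityTheory

namespace DiscreteMaxima

noncomputable section

/-- The tail `∑_{i ≥ n} p_i` of the distribution `(i, p_i)`, `i ≥ 0`. -/
def tail (p : ℕ → ℝ) (n : ℕ) : ℝ := ∑' i : ℕ, p (n + i)

/-- `R(n) = -ln ∑_{i ≥ n} p_i`. -/
def R (p : ℕ → ℝ) (n : ℕ) : ℝ := -Real.log (tail p n)

/-- `r(n) = R(n) - R(n-1)`, used for `n ≥ 1` only. -/
def r (p : ℕ → ℝ) (n : ℕ) : ℝ := R p n - R p (n - 1)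

/-- `a_n = max {k ≥ 0 : ∑_{i ≥ k} p_i ≥ 1/n}`, used for `n ≥ 1`; the maximum exists by
`isGreatest_a` below. -/
def a (p : ℕ → ℝ) (n : ℕ) : ℕ := sSup {k : ℕ | 1 / (n : ℝ) ≤ tail p k}

/-- For a probability distribution and `n ≥ 1` the supremum defining `a_n` is a maximum. -/
theorem isGreatest_a (p : ℕ → ℝ) (hp : HasSum p 1) (n : ℕ) (hn : 1 ≤ n) :
    IsGreatest {k : ℕ | 1 / (n : ℝ) ≤ tail p k} (a p n) := by
  have hn' : (1 : ℝ) ≤ n := by exact_mod_cast hn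
  have hne : {k : ℕ | 1 / (n : ℝ) ≤ tail p k}.Nonempty := by
    refine ⟨0, ?_⟩
    have h0 : tail p 0 = 1 := by simp [tail, hp.tsum_eq]
    rw [Set.mem_ofPred_eq, h0]
    exact (div_le_one (by linarith)).2 hn'
  have hbdd : BddAbove {k : ℕ | 1 / (n : ℝ) ≤ tail p k} := by
    have hlim : Tendsto (fun k => tail p k) atTop (𝓝 0) := by
      simpa [tail, add_comm] using tendsto_sum_nat_add p
    have hpos : (0 : ℝ) < 1 / n := by positivity
    obtain ⟨N, hN⟩ := eventually_atTop.1 (hlim.eventually (gt_mem_nhds hpos))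
    refine ⟨N, fun k hk => ?_⟩
    by_contra hlt
    exact absurd (hN k (by omega)) (not_lt.2 hk)
  exact ⟨Nat.sSup_mem hne hbdd, fun k hk => le_csSup hbdd hk⟩

/-- The maximum of the first `n` variables of the sequence `ξ 0, ξ 1, …` (the variables
`ξ_1, ξ_2, …` of the text, numbered from zero); used for `n ≥ 1`. -/
def maxFirst {Ω : Type*} (ξ : ℕ → Ω → ℕ) (n : ℕ) (ω : Ω) : ℕ :=
  (Finset.range n).sup (fun i => ξ i ω)

/-- The event that the maximum of the first `n` variables equals `a_n + l` for infinitely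
many `n`. -/
def eventIO {Ω : Type*} (p : ℕ → ℝ) (ξ : ℕ → Ω → ℕ) (l : ℕ) : Set Ω :=
  {ω | ∃ᶠ n in atTop, maxFirst ξ n ω = a p n + l}

end

end DiscreteMaxima

/-! Write T_k for `tail p k`. The indices n with a_n = k are those with 1/T_k ≤ n < 1/T_{k+1}. Among
about 1/T_{k+1} variables, the expected number reaching k+l is about T_{k+l}/T_{k+1}. For l ≤ 1 this
ratio is at least 1; for l > 1 it is exp(-(r(k+2)+…+r(k+l))). As r tends to infinity it is
increasing, so the ratio lies between exp(-(l-1)r(k+l)) and exp(-(l-1)r(k+2)), terms of shifts of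
the given series.

If the series converges, a union bound and Borel–Cantelli suffice (`measure_eventIO_eq_zero`).
Otherwise let C_k say that the maximum over a block of indices is exactly k+l, and D_k that no
earlier variable exceeds k+l. The blocks are disjoint, so the C_k are independent, with non-summable
probabilities (`eventually_block_pow_sub_pow`). Since r → ∞, P(D_k) → 1, and
`measure_limsup_inter_eq_one` gives C_k ∩ D_k infinitely often (`measure_eventIO_eq_one`). -/

namespace DiscreteMaxima

/-! ### Borel–Cantelli with asymptotically certain side events -/

/-- A Feller–Chung type inequality: intersecting events `C k` with events `D k` that are independent
of the `σ`-algebra `m k` generated by the present and the future costs at most a factor `d` in the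
probability of a union. -/
theorem mul_measureReal_iUnion_le {Ω : Type*} [mΩ : MeasurableSpace Ω] {P : Measure Ω}
    [IsProbabilityMeasure P] {C D : ℕ → Set Ω} {m : ℕ → MeasurableSpace Ω}
    (hm : ∀ k, m k ≤ mΩ) (hanti : Antitone m) (hC : ∀ k, MeasurableSet[m k] (C k))
    (hD : ∀ k, MeasurableSet (D k))
    (hind : ∀ k t, MeasurableSet[m k] t → P.real (D k ∩ t) = P.real (D k) * P.real t)
    {d : ℝ} (n : ℕ) : ∀ k₀, (∀ k, k₀ ≤ k → d ≤ P.real (D k)) →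
      d * P.real (⋃ j < n, C (k₀ + j)) ≤ P.real (⋃ j < n, C (k₀ + j) ∩ D (k₀ + j)) := by
  induction n with
  | zero => intro k₀ _; simp
  | succ n ih =>
    intro k₀ hd
    have hU : MeasurableSet[m (k₀ + 1)] (⋃ j < n, C (k₀ + 1 + j)) :=
      MeasurableSet.biUnion (Set.to_countable _) fun j _ => hanti (Nat.le_add_right _ _) _ (hC _)
    have hV : MeasurableSet (⋃ j < n, C (k₀ + 1 + j) ∩ D (k₀ + 1 + j)) :=
      MeasurableSet.biUnion (Set.to_countable _) fun j _ => (hm _ _ (hC _)).inter (hD _)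
    have split (f : ℕ → Set Ω) : ⋃ j < n + 1, f (k₀ + j) = f k₀ ∪ ⋃ j < n, f (k₀ + 1 + j) := by
      ext ω
      simp only [Set.mem_iUnion, Set.mem_union, exists_prop]
      constructor
      · rintro ⟨_ | j, hj, h⟩
        · exact Or.inl h
        · exact Or.inr ⟨j, by omega, by rwa [add_right_comm, add_assoc]⟩
      · rintro (h | ⟨j, hj, h⟩)
        · exact ⟨0, by omega, h⟩
        · exact ⟨j + 1, by omega, by rwa [add_right_comm, add_assoc] at h⟩
    rw [split C, split fun k => C k ∩ D k]
    set U := ⋃ j < n, C (k₀ + 1 + j) with hUdef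
    set V := ⋃ j < n, C (k₀ + 1 + j) ∩ D (k₀ + 1 + j) with hVdef
    have hVU : V ⊆ U := Set.iUnion₂_mono fun j _ => Set.inter_subset_left
    -- On `C k₀ \ U` the last occurrence is at `k₀`; this set involves only present and future,
    -- hence is independent of `D k₀`.
    have hF : MeasurableSet[m k₀] (C k₀ \ U) := (hC k₀).diff (hanti (Nat.le_succ _) _ hU)
    have h1 := ih (k₀ + 1) fun k hk => hd k (by omega)
    have h2 : P.real (C k₀ ∪ U) = P.real U + P.real (C k₀ \ U) := by
      rw [Set.union_comm, ← Set.union_sdiff_self]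
      exact measureReal_union Set.disjoint_sdiff_right (hm _ _ hF) (measure_ne_top _ _)
        (measure_ne_top _ _)
    have h3 : P.real V + P.real (D k₀ ∩ (C k₀ \ U)) ≤ P.real (C k₀ ∩ D k₀ ∪ V) := by
      rw [← measureReal_union (Disjoint.mono hVU Set.inter_subset_right Set.disjoint_sdiff_right)
        ((hD _).inter (hm _ _ hF)) (measure_ne_top _ _) (measure_ne_top _ _)]
      refine measureReal_mono ?_
      rintro ω (h | ⟨h, h', -⟩)
      · exact Or.inr h
      · exact Or.inl ⟨h', h⟩
    rw [hind _ _ hF] at h3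
    have h4 := mul_le_mul_of_nonneg_right (hd k₀ le_rfl) (measureReal_nonneg (μ := P) (s := C k₀ \ U))
    rw [h2]
    linarith

/-- A second Borel–Cantelli lemma for independent events `C k` intersected with events `D k` of the
past whose probabilities tend to one. -/
theorem measure_limsup_inter_eq_one {Ω : Type*} [mΩ : MeasurableSpace Ω] {P : Measure Ω}
    [IsProbabilityMeasure P] {C D : ℕ → Set Ω} {m : ℕ → MeasurableSpace Ω}
    (hm : ∀ k, m k ≤ mΩ) (hanti : Antitone m) (hC : ∀ k, MeasurableSet[m k] (C k))
    (hD : ∀ k, MeasurableSet (D k))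
    (hind : ∀ k t, MeasurableSet[m k] t → P.real (D k ∩ t) = P.real (D k) * P.real t)
    (hlim : Tendsto (fun k => P.real (D k)) atTop (𝓝 1))
    (hCind : iIndepSet C P) (hsum : ¬ Summable fun k => P.real (C k)) :
    P (limsup (fun k => C k ∩ D k) atTop) = 1 := by
  have hE : ∀ k, MeasurableSet (C k ∩ D k) := fun k => (hm _ _ (hC k)).inter (hD k)
  have htop : ∑' k, P (C k) = ⊤ := by
    by_contra h
    exact hsum (ENNReal.summable_toReal h)
  have hC1 : P (limsup C atTop) = 1 :=
    measure_limsup_eq_one (fun k => hm _ _ (hC k)) hCind htop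
  have hU1 (k : ℕ) : P.real (⋃ j, C (k + j)) = 1 := by
    have : P (⋃ j, C (k + j)) = 1 := by
      refine le_antisymm prob_le_one (hC1 ▸ measure_mono fun ω hω => ?_)
      obtain ⟨i, hi, h⟩ := (frequently_atTop.1 (mem_limsup_iff_frequently_mem.1 hω)) k
      exact Set.mem_iUnion.2 ⟨i - k, by rwa [Nat.add_sub_cancel' hi]⟩
    simp [measureReal_def, this]
  have hcont (f : ℕ → Set Ω) :
      Tendsto (fun n => P.real (⋃ j < n, f j)) atTop (𝓝 (P.real (⋃ j, f j))) := by
    have h := tendsto_measure_iUnion_atTop (μ := P) (s := fun n => ⋃ j < n, f j)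
      fun a b hab => Set.biUnion_subset_biUnion_left fun j hj => lt_of_lt_of_le hj hab
    have h' : (⋃ n, ⋃ j < n, f j) = ⋃ j, f j := by
      ext ω
      simp only [Set.mem_iUnion, exists_prop]
      exact ⟨fun ⟨_, j, _, h⟩ => ⟨j, h⟩, fun ⟨j, h⟩ => ⟨j + 1, j, by omega, h⟩⟩
    rw [h'] at h
    exact (ENNReal.tendsto_toReal (measure_ne_top _ _)).comp h
  have hV (d : ℝ) (hd : d < 1) : ∀ᶠ k in atTop, d ≤ P.real (⋃ j, C (k + j) ∩ D (k + j)) := by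
    obtain ⟨K, hK⟩ := eventually_atTop.1 (hlim.eventually (lt_mem_nhds hd))
    filter_upwards [eventually_ge_atTop K] with k hk
    have := le_of_tendsto_of_tendsto' ((hcont fun j => C (k + j)).const_mul d)
      (hcont fun j => C (k + j) ∩ D (k + j)) fun n =>
        mul_measureReal_iUnion_le hm hanti hC hD hind n k fun i hi => (hK i (hk.trans hi)).le
    simpa [hU1] using this
  have hlimsup : limsup (fun k => C k ∩ D k) atTop = ⋂ k, ⋃ j, C (k + j) ∩ D (k + j) := by
    ext ω
    rw [mem_limsup_iff_frequently_mem, frequently_atTop]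
    simp only [Set.mem_iInter, Set.mem_iUnion]
    refine forall_congr' fun k => ⟨fun ⟨i, hi, h⟩ => ⟨i - k, ?_⟩, fun ⟨j, h⟩ => ⟨k + j, by omega, h⟩⟩
    rwa [Nat.add_sub_cancel' hi]
  have hdown := tendsto_measure_iInter_atTop (μ := P) (s := fun k => ⋃ j, C (k + j) ∩ D (k + j))
    (fun k => (MeasurableSet.iUnion fun j => hE _).nullMeasurableSet)
    (fun a b hab => Set.iUnion_subset fun j => by
      have := Set.subset_iUnion (fun j => C (a + j) ∩ D (a + j)) (b - a + j)
      rwa [← add_assoc, Nat.add_sub_cancel' hab] at this)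
    ⟨0, measure_ne_top _ _⟩
  rw [← hlimsup] at hdown
  have hreal := (ENNReal.tendsto_toReal (measure_ne_top _ _)).comp hdown
  have h1 : 1 ≤ P.real (limsup (fun k => C k ∩ D k) atTop) :=
    le_of_forall_lt fun d hd => by
      obtain ⟨d', hd', h'⟩ := exists_between hd
      exact hd'.trans_le (ge_of_tendsto hreal (hV d' h'))
  refine le_antisymm prob_le_one ?_
  rw [measureReal_def] at h1
  simpa using (ENNReal.ofReal_le_iff_le_toReal (measure_ne_top _ _)).2 h1

/-! ### Independence over disjoint index sets -/

section Independence

variable {Ω : Type*} {ξ : ℕ → Ω → ℕ}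

/-- The `σ`-algebra generated by the variables with indices in `S`. -/
abbrev sigmaOf (ξ : ℕ → Ω → ℕ) (S : Set ℕ) : MeasurableSpace Ω :=
  ⨆ i ∈ S, MeasurableSpace.comap (ξ i) ⊤

theorem sigmaOf_mono {S T : Set ℕ} (h : S ⊆ T) : sigmaOf ξ S ≤ sigmaOf ξ T :=
  biSup_mono fun _ hi => h hi

theorem measurableSet_sigmaOf {S : Set ℕ} {i : ℕ} (hi : i ∈ S) (B : Set ℕ) :
    MeasurableSet[sigmaOf ξ S] {ω | ξ i ω ∈ B} :=
  le_iSup₂ (f := fun i (_ : i ∈ S) => MeasurableSpace.comap (ξ i) ⊤) i hi _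
    ⟨B, trivial, rfl⟩

/-- All variables with indices in `s` are smaller than `b`. -/
def allLT (ξ : ℕ → Ω → ℕ) (s : Finset ℕ) (b : ℕ) : Set Ω := ⋂ i ∈ s, {ω | ξ i ω ∈ Set.Iio b}

theorem mem_allLT {s : Finset ℕ} {b : ℕ} {ω : Ω} : ω ∈ allLT ξ s b ↔ ∀ i ∈ s, ξ i ω < b := by
  simp [allLT]

theorem measurableSet_allLT {S : Set ℕ} {s : Finset ℕ} (h : ↑s ⊆ S) (b : ℕ) :
    MeasurableSet[sigmaOf ξ S] (allLT ξ s b) :=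
  Finset.measurableSet_biInter _ fun _ hi => measurableSet_sigmaOf (h hi) _

variable [mΩ : MeasurableSpace Ω] {P : Measure Ω}

theorem sigmaOf_le (hξ : ∀ n, Measurable (ξ n)) (S : Set ℕ) : sigmaOf ξ S ≤ mΩ :=
  iSup₂_le fun i _ => (hξ i).comap_le

theorem indep_sigmaOf (hξ : ∀ n, Measurable (ξ n)) (hind : iIndepFun ξ P) {S T : Set ℕ}
    (h : Disjoint S T) : Indep (sigmaOf ξ S) (sigmaOf ξ T) P :=
  indep_iSup_of_disjoint (fun i => (hξ i).comap_le) hind h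

theorem measureReal_inter_sigmaOf (hξ : ∀ n, Measurable (ξ n)) (hind : iIndepFun ξ P)
    {S T : Set ℕ} (h : Disjoint S T) {A B : Set Ω} (hA : MeasurableSet[sigmaOf ξ S] A)
    (hB : MeasurableSet[sigmaOf ξ T] B) : P.real (A ∩ B) = P.real A * P.real B := by
  have := (Indep_iff _ _ _).1 (indep_sigmaOf hξ hind h) A B hA hB
  simp [measureReal_def, this]

theorem iIndepSet_of_sigmaOf [IsProbabilityMeasure P] (hξ : ∀ n, Measurable (ξ n))
    (hind : iIndepFun ξ P) {I : ℕ → Set ℕ} (hI : Pairwise (Function.onFun Disjoint I))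
    {C : ℕ → Set Ω} (hC : ∀ k, MeasurableSet[sigmaOf ξ (I k)] (C k)) : iIndepSet C P := by
  rw [iIndepSet_iff_meas_biInter fun k => sigmaOf_le hξ _ _ (hC k)]
  intro s
  induction s using Finset.induction_on with
  | empty => simp
  | insert k s hk ih =>
    rw [Finset.set_biInter_insert, Finset.prod_insert hk, ← ih]
    refine (Indep_iff _ _ _).1 (indep_sigmaOf hξ hind (S := I k) (T := ⋃ j ∈ s, I j) ?_) _ _
      (hC k) ?_
    · rw [Set.disjoint_iUnion₂_right]
      exact fun j hj => hI fun h => hk (h ▸ hj)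
    · exact Finset.measurableSet_biInter _ fun j hj =>
        sigmaOf_mono (Set.subset_biUnion_of_mem (u := I) hj) _ (hC j)

end Independence

/-! ### Distribution of a single variable and of maxima -/

section Law

variable {Ω : Type*} [MeasurableSpace Ω] {P : Measure Ω} [IsProbabilityMeasure P] {p : ℕ → ℝ}
  {ξ : ℕ → Ω → ℕ}

theorem tail_zero (hp : HasSum p 1) : tail p 0 = 1 := by simp [tail, hp.tsum_eq]

theorem tail_eq_add (hp : HasSum p 1) (n : ℕ) : tail p n = p n + tail p (n + 1) := by
  have h : Summable fun i => p (n + i) := by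
    simpa only [add_comm] using (summable_nat_add_iff n).2 hp.summable
  have := h.tsum_eq_zero_add
  simpa [tail, add_assoc, add_comm, add_left_comm] using this

theorem tendsto_tail (p : ℕ → ℝ) : Tendsto (tail p) atTop (𝓝 0) := by
  simpa [funext_iff, tail, add_comm] using! tendsto_sum_nat_add p

theorem measureReal_lt (hp_pos : ∀ i, 0 < p i) (hp : HasSum p 1) (hξ : ∀ n, Measurable (ξ n))
    (hlaw : ∀ n i, P {ω | ξ n ω = i} = ENNReal.ofReal (p i)) (n b : ℕ) :
    P.real {ω | ξ n ω ∈ Set.Iio b} = 1 - tail p b := by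
  induction b with
  | zero => simp [tail_zero hp]
  | succ b ih =>
    have h : {ω | ξ n ω ∈ Set.Iio (b + 1)} = {ω | ξ n ω ∈ Set.Iio b} ∪ {ω | ξ n ω = b} := by
      ext ω
      simp only [Set.mem_ofPred_eq, Set.mem_Iio, Set.mem_union]
      omega
    rw [h, measureReal_union, ih, measureReal_def P {ω | ξ n ω = b}, hlaw,
      ENNReal.toReal_ofReal (hp_pos b).le, tail_eq_add hp b]
    · ring
    · refine Set.disjoint_left.2 fun ω h1 h2 => ?_
      simp only [Set.mem_ofPred_eq, Set.mem_Iio] at h1 h2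
      omega
    · exact hξ n (measurableSet_singleton b)

theorem measureReal_allLT (hp_pos : ∀ i, 0 < p i) (hp : HasSum p 1) (hξ : ∀ n, Measurable (ξ n))
    (hlaw : ∀ n i, P {ω | ξ n ω = i} = ENNReal.ofReal (p i)) (hind : iIndepFun ξ P)
    (s : Finset ℕ) (b : ℕ) : P.real (allLT ξ s b) = (1 - tail p b) ^ s.card := by
  have h := hind.measure_inter_preimage_eq_mul s (sets := fun _ => Set.Iio b)
    fun _ _ => MeasurableSet.of_discrete
  have h' : P (allLT ξ s b) = ∏ i ∈ s, P {ω | ξ i ω ∈ Set.Iio b} := h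
  rw [measureReal_def, h', ENNReal.toReal_prod, ← Finset.prod_const]
  exact Finset.prod_congr rfl fun i _ => measureReal_lt hp_pos hp hξ hlaw i b

end Law

/-! ### Tail ratios, the sequence a_n and its blocks -/

section Tail

variable {p : ℕ → ℝ}

theorem tail_pos (hp_pos : ∀ i, 0 < p i) (hp : HasSum p 1) (n : ℕ) : 0 < tail p n := by
  rw [tail_eq_add hp]
  exact add_pos_of_pos_of_nonneg (hp_pos n) (tsum_nonneg fun i => (hp_pos _).le)

theorem antitone_tail (hp_pos : ∀ i, 0 < p i) (hp : HasSum p 1) : Antitone (tail p) :=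
  antitone_nat_of_succ_le fun n => by linarith [tail_eq_add hp n, hp_pos n]

theorem tail_le_one (hp_pos : ∀ i, 0 < p i) (hp : HasSum p 1) (n : ℕ) : tail p n ≤ 1 :=
  tail_zero hp ▸ antitone_tail hp_pos hp (Nat.zero_le n)

theorem tail_succ (hp_pos : ∀ i, 0 < p i) (hp : HasSum p 1) (n : ℕ) :
    tail p (n + 1) = tail p n * Real.exp (-r p (n + 1)) := by
  have h0 := tail_pos hp_pos hp n
  have h1 := tail_pos hp_pos hp (n + 1)
  simp only [r, R, Nat.add_sub_cancel]
  rw [neg_sub, sub_neg_eq_add, neg_add_eq_sub, Real.exp_sub, Real.exp_log h0, Real.exp_log h1]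
  field_simp

theorem tail_add_le (hp_pos : ∀ i, 0 < p i) (hp : HasSum p 1) {c : ℝ} (k j : ℕ)
    (h : ∀ i, k < i → c ≤ r p i) : tail p (k + j) ≤ tail p k * Real.exp (-(j * c)) := by
  induction j with
  | zero => simp
  | succ j ih =>
    rw [← add_assoc, tail_succ hp_pos hp, show -(((j + 1 : ℕ) : ℝ) * c) = -(j * c) + -c by
      push_cast; ring, Real.exp_add, ← mul_assoc]
    have := h (k + j + 1) (by omega)
    have h3 := tail_pos hp_pos hp k
    gcongr

theorem le_tail_add (hp_pos : ∀ i, 0 < p i) (hp : HasSum p 1) {c : ℝ} (k j : ℕ)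
    (h : ∀ i, k < i → i ≤ k + j → r p i ≤ c) :
    tail p k * Real.exp (-(j * c)) ≤ tail p (k + j) := by
  induction j with
  | zero => simp
  | succ j ih =>
    rw [← add_assoc, tail_succ hp_pos hp, show -(((j + 1 : ℕ) : ℝ) * c) = -(j * c) + -c by
      push_cast; ring, Real.exp_add, ← mul_assoc]
    have h1 := h (k + j + 1) (by omega) (by omega)
    have h2 := ih fun i hi hi' => h i hi (by omega)
    have h3 := tail_pos hp_pos hp (k + j)
    gcongr

theorem a_eq (hp_pos : ∀ i, 0 < p i) (hp : HasSum p 1) {n k : ℕ} (hn : 1 ≤ n)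
    (h : 1 / (n : ℝ) ≤ tail p k) (h' : tail p (k + 1) < 1 / (n : ℝ)) : a p n = k := by
  obtain ⟨h1, h2⟩ := isGreatest_a p hp n hn
  refine le_antisymm ?_ (h2 h)
  by_contra hlt
  exact absurd (h1.trans (antitone_tail hp_pos hp (show k + 1 ≤ a p n by omega))) (not_le.2 h')

theorem tail_a_add_one_lt (hp : HasSum p 1) {n : ℕ} (hn : 1 ≤ n) :
    tail p (a p n + 1) < 1 / (n : ℝ) := by
  by_contra hlt
  have := (isGreatest_a p hp n hn).2 (not_lt.1 hlt)
  omega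

theorem tendsto_a (hp_pos : ∀ i, 0 < p i) (hp : HasSum p 1) : Tendsto (a p) atTop atTop := by
  refine tendsto_atTop.2 fun k => ?_
  filter_upwards [eventually_ge_atTop ⌈1 / tail p k⌉₊, eventually_ge_atTop 1] with n hn hn1
  refine (isGreatest_a p hp n hn1).2 ?_
  rw [Set.mem_ofPred_eq, one_div_le (by exact_mod_cast hn1) (tail_pos hp_pos hp k)]
  exact Nat.ceil_le.1 hn

/-- The first index `n` with `a p n = k`, provided there is one. -/
noncomputable def blockStart (p : ℕ → ℝ) (k : ℕ) : ℕ := ⌈1 / tail p k⌉₊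

/-- The end of a block of indices `n` with `a p n = k`. -/
noncomputable def blockStop (p : ℕ → ℝ) (k : ℕ) : ℕ :=
  min (blockStart p k + ⌊1 / (2 * tail p (k + 1))⌋₊) (blockStart p (k + 1))

theorem monotone_blockStart (hp_pos : ∀ i, 0 < p i) (hp : HasSum p 1) :
    Monotone (blockStart p) := fun _ _ h =>
  Nat.ceil_mono (one_div_le_one_div_of_le (tail_pos hp_pos hp _) (antitone_tail hp_pos hp h))

theorem one_le_blockStart (hp_pos : ∀ i, 0 < p i) (hp : HasSum p 1) (k : ℕ) :
    1 ≤ blockStart p k :=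
  Nat.ceil_pos.2 (one_div_pos.2 (tail_pos hp_pos hp k))

/-- The cap `blockStart p (k + 1)` in `blockStop` gives this for every k; it is inactive for large
k. -/
theorem pairwise_disjoint_blocks (hp_pos : ∀ i, 0 < p i) (hp : HasSum p 1) :
    Pairwise (Function.onFun Disjoint fun k => Set.Ico (blockStart p k) (blockStop p k)) := by
  refine (pairwise_disjoint_on _).2 fun i j hij => Set.disjoint_left.2 fun n hi hj => ?_
  have h1 := monotone_blockStart hp_pos hp (show i + 1 ≤ j from hij)
  have h2 : blockStop p i ≤ blockStart p (i + 1) := min_le_right _ _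
  have h3 := hi.2
  have h4 := hj.1
  omega

theorem tendsto_exp_neg_r (hr : Tendsto (r p) atTop atTop) :
    Tendsto (fun k => Real.exp (-r p k)) atTop (𝓝 0) :=
  Real.tendsto_exp_neg_atTop_nhds_zero.comp hr

/-- Up to rounding the product is T_{k+1}/T_k = exp(-r(k+1)). It bounds the chance that a variable
before the block reaches k+1. -/
theorem tendsto_blockStart_mul_tail (hp_pos : ∀ i, 0 < p i) (hp : HasSum p 1)
    (hr : Tendsto (r p) atTop atTop) :
    Tendsto (fun k => (blockStart p k : ℝ) * tail p (k + 1)) atTop (𝓝 0) := by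
  have h := ((tendsto_add_atTop_iff_nat 1).2 (tendsto_exp_neg_r hr)).add
    ((tendsto_add_atTop_iff_nat 1).2 (tendsto_tail p))
  rw [add_zero] at h
  refine squeeze_zero (fun k => mul_nonneg (Nat.cast_nonneg _) (tail_pos hp_pos hp _).le)
    (fun k => ?_) h
  have h0 := tail_pos hp_pos hp k
  have h1 := tail_pos hp_pos hp (k + 1)
  have h2 : (blockStart p k : ℝ) ≤ 1 / tail p k + 1 :=
    (Nat.ceil_lt_add_one (one_div_pos.2 h0).le).le
  calc (blockStart p k : ℝ) * tail p (k + 1) ≤ (1 / tail p k + 1) * tail p (k + 1) := by gcongr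
    _ = tail p (k + 1) / tail p k + tail p (k + 1) := by ring
    _ = Real.exp (-r p (k + 1)) + tail p (k + 1) := by
      congr 1
      rw [tail_succ hp_pos hp]
      field_simp

/-- The second clause ensures a_n = k still holds at n = `blockStop p k`: the block length
contributes at most 1/2, its start less than 1/2. -/
theorem eventually_blockStop (hp_pos : ∀ i, 0 < p i) (hp : HasSum p 1)
    (hr : Tendsto (r p) atTop atTop) :
    ∀ᶠ k in atTop, blockStop p k = blockStart p k + ⌊1 / (2 * tail p (k + 1))⌋₊ ∧
      (blockStop p k : ℝ) * tail p (k + 1) < 1 := by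
  filter_upwards [(tendsto_blockStart_mul_tail hp_pos hp hr).eventually
    (gt_mem_nhds (show (0 : ℝ) < 1 / 2 by norm_num))] with k hk
  have h1 := tail_pos hp_pos hp (k + 1)
  have h2 : (⌊1 / (2 * tail p (k + 1))⌋₊ : ℝ) * tail p (k + 1) ≤ 1 / 2 := by
    calc _ ≤ 1 / (2 * tail p (k + 1)) * tail p (k + 1) := by
          gcongr
          exact Nat.floor_le (by positivity)
      _ = 1 / 2 := by field_simp
  have h3 : ((blockStart p k + ⌊1 / (2 * tail p (k + 1))⌋₊ : ℕ) : ℝ) * tail p (k + 1) < 1 := by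
    push_cast
    linarith
  have h4 : blockStop p k = blockStart p k + ⌊1 / (2 * tail p (k + 1))⌋₊ := by
    refine min_eq_left (Nat.cast_le (α := ℝ).1 (le_trans ?_ (Nat.le_ceil _)))
    rw [le_div_iff₀ h1]
    exact h3.le
  exact ⟨h4, h4 ▸ h3⟩

/-- With u = T_{k+l+1} and t = T_{k+l}, the right side is the probability that L variables have
maximum k+l. It is at least (1-u)^L (1 - (1-(t-u))^L): Bernoulli bounds the first factor by 1/2, an
exponential estimate the second by x/3. -/
theorem div_six_le_pow_sub_pow {u t x : ℝ} {L : ℕ} (hu : 0 ≤ u) (hut : u ≤ t / 2) (ht : t ≤ 1)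
    (hLu : L * u ≤ 1 / 2) (hx0 : 0 ≤ x) (hx1 : x ≤ 1) (hx : x ≤ L * t) :
    x / 6 ≤ (1 - u) ^ L - (1 - t) ^ L := by
  have hL : (0 : ℝ) ≤ L := Nat.cast_nonneg L
  have h1 : 1 / 2 ≤ (1 - u) ^ L := by
    have := one_add_mul_le_pow (show (-2 : ℝ) ≤ -u by linarith) L
    rw [← sub_eq_add_neg] at this
    linarith
  have h2 : (1 - t) ^ L ≤ (1 - u) ^ L * (1 - (t - u)) ^ L := by
    rw [← mul_pow]
    refine pow_le_pow_left₀ (by linarith) ?_ L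
    -- The difference of the two sides is u(t-u).
    nlinarith
  have hy : x / 2 ≤ L * (t - u) := by
    have := mul_le_mul_of_nonneg_left hut hL
    linarith
  have h3 : (1 - (t - u)) ^ L ≤ 1 - x / 3 := by
    have e1 : (1 - (t - u)) ^ L ≤ Real.exp (-(t - u)) ^ L :=
      pow_le_pow_left₀ (by linarith) (by linarith [Real.add_one_le_exp (-(t - u))]) L
    rw [← Real.exp_nat_mul] at e1
    have e2 : Real.exp (L * -(t - u)) ≤ Real.exp (-(x / 2)) := Real.exp_le_exp.2 (by linarith)
    have e3 : Real.exp (-(x / 2)) ≤ (1 + x / 2)⁻¹ := by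
      rw [Real.exp_neg]
      exact inv_anti₀ (by linarith) (by linarith [Real.add_one_le_exp (x / 2)])
    have e4 : (1 + x / 2)⁻¹ ≤ 1 - x / 3 := by
      rw [inv_le_iff_one_le_mul₀ (by linarith)]
      -- (1 - x/3)(1 + x/2) - 1 = x(1-x)/6.
      nlinarith
    linarith
  have h4 := mul_le_mul_of_nonneg_left h3 (show 0 ≤ (1 - u) ^ L by linarith)
  have h5 := mul_le_mul_of_nonneg_right h1 (show 0 ≤ x / 3 by linarith)
  linarith

theorem eventually_block_pow_sub_pow (hp_pos : ∀ i, 0 < p i) (hp : HasSum p 1)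
    (hr : Tendsto (r p) atTop atTop) (l : ℕ) {q : ℕ → ℝ} (hq0 : ∀ k, 0 ≤ q k)
    (hq1 : ∀ᶠ k in atTop, q k ≤ 1)
    (hq : ∀ k, q k * tail p (k + 1) ≤ tail p (k + l)) :
    ∀ᶠ k in atTop, q k / 24 ≤
      (1 - tail p (k + l + 1)) ^ (blockStop p k - blockStart p k) -
        (1 - tail p (k + l)) ^ (blockStop p k - blockStart p k) := by
  filter_upwards [hq1, eventually_blockStop hp_pos hp hr,
    ((tendsto_add_atTop_iff_nat (l + 1)).2 (tendsto_exp_neg_r hr)).eventually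
      (gt_mem_nhds (show (0 : ℝ) < 1 / 2 by norm_num)),
    ((tendsto_add_atTop_iff_nat 1).2 (tendsto_tail p)).eventually
      (gt_mem_nhds (show (0 : ℝ) < 1 / 4 by norm_num))] with k h1 ⟨h2, _⟩ h3 h4
  rw [h2, Nat.add_sub_cancel_left]
  set T := tail p (k + 1)
  have hT : 0 < T := tail_pos hp_pos hp _
  have hL1 : (⌊1 / (2 * T)⌋₊ : ℝ) * T ≤ 1 / 2 := by
    calc _ ≤ 1 / (2 * T) * T := by
          gcongr
          exact Nat.floor_le (by positivity)
      _ = 1 / 2 := by field_simp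
  -- Rounding down costs at most T < 1/4 out of 1/2; hence x = q k / 4 below, and 24 = 4·6.
  have hL2 : 1 / 4 ≤ (⌊1 / (2 * T)⌋₊ : ℝ) * T := by
    have := mul_le_mul_of_nonneg_right (Nat.lt_floor_add_one (1 / (2 * T))).le hT.le
    have e : 1 / (2 * T) * T = 1 / 2 := by field_simp
    linarith
  have hu : tail p (k + l + 1) ≤ tail p (k + l) / 2 := by
    rw [tail_succ hp_pos hp, div_eq_mul_one_div]
    exact mul_le_mul_of_nonneg_left h3.le (tail_pos hp_pos hp _).le
  have := div_six_le_pow_sub_pow (L := ⌊1 / (2 * T)⌋₊) (x := q k / 4)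
    (tail_pos hp_pos hp (k + l + 1)).le hu (tail_le_one hp_pos hp _)
    (le_trans (mul_le_mul_of_nonneg_left (antitone_tail hp_pos hp (by omega))
      (Nat.cast_nonneg _)) hL1) (by linarith [hq0 k]) (by linarith) ?_
  · linarith
  · calc q k / 4 = q k * (1 / 4) := by ring
      _ ≤ q k * (⌊1 / (2 * T)⌋₊ * T) := mul_le_mul_of_nonneg_left hL2 (hq0 k)
      _ = ⌊1 / (2 * T)⌋₊ * (q k * T) := by ring
      _ ≤ _ := mul_le_mul_of_nonneg_left (hq k) (Nat.cast_nonneg _)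

end Tail

/-! ### The two halves of the dichotomy -/

section Events

variable {Ω : Type*} [MeasurableSpace Ω] {P : Measure Ω} [IsProbabilityMeasure P] {p : ℕ → ℝ}
  {ξ : ℕ → Ω → ℕ}

/-- If `q k` is a minorant of `tail p (k + l) / tail p (k + 1)` with a divergent sum, then the
maximum equals `a_n + l` infinitely often almost surely. -/
theorem measure_eventIO_eq_one (hp_pos : ∀ i, 0 < p i) (hp : HasSum p 1)
    (hξ : ∀ n, Measurable (ξ n)) (hind : iIndepFun ξ P)
    (hlaw : ∀ n i, P {ω | ξ n ω = i} = ENNReal.ofReal (p i))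
    (hr : Tendsto (r p) atTop atTop) (l : ℕ) {q : ℕ → ℝ} (hq0 : ∀ k, 0 ≤ q k)
    (hq1 : ∀ᶠ k in atTop, q k ≤ 1) (hq : ∀ k, q k * tail p (k + 1) ≤ tail p (k + l))
    (hsum : ¬ Summable q) : P (eventIO p ξ l) = 1 := by
  set I : ℕ → Finset ℕ := fun k => Finset.Ico (blockStart p k) (blockStop p k)
  set C : ℕ → Set Ω := fun k => allLT ξ (I k) (k + l + 1) \ allLT ξ (I k) (k + l) with hCdef
  set D : ℕ → Set Ω := fun k => allLT ξ (Finset.range (blockStart p k)) (k + l + 1) with hDdef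
  set m : ℕ → MeasurableSpace Ω := fun k => sigmaOf ξ (Set.Ici (blockStart p k))
  have hm : ∀ k, m k ≤ ‹MeasurableSpace Ω› := fun k => sigmaOf_le hξ _
  have hCI (k : ℕ) :
      MeasurableSet[sigmaOf ξ (Set.Ico (blockStart p k) (blockStop p k))] (C k) :=
    (measurableSet_allLT (by simp [I]) _).diff (measurableSet_allLT (by simp [I]) _)
  have hCm (k : ℕ) : MeasurableSet[m k] (C k) := sigmaOf_mono Set.Ico_subset_Ici_self _ (hCI k)
  have hDI (k : ℕ) : MeasurableSet[sigmaOf ξ (Set.Iio (blockStart p k))] (D k) :=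
    measurableSet_allLT (by simp) _
  have hlt (s : Finset ℕ) (b : ℕ) := measureReal_allLT hp_pos hp hξ hlaw hind s b
  have hPC (k : ℕ) : P.real (C k) = (1 - tail p (k + l + 1)) ^ (blockStop p k - blockStart p k) -
      (1 - tail p (k + l)) ^ (blockStop p k - blockStart p k) := by
    rw [hCdef, measureReal_sdiff, hlt, hlt, Nat.card_Ico]
    · exact fun ω h => mem_allLT.2 fun i hi => (mem_allLT.1 h i hi).trans (Nat.lt_succ_self _)
    · exact sigmaOf_le hξ Set.univ _ (measurableSet_allLT (Set.subset_univ _) _)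
  have hPD : Tendsto (fun k => P.real (D k)) atTop (𝓝 1) := by
    have h := (tendsto_blockStart_mul_tail hp_pos hp hr).const_sub 1
    rw [sub_zero] at h
    refine tendsto_of_tendsto_of_tendsto_of_le_of_le h tendsto_const_nhds (fun k => ?_)
      fun k => measureReal_le_one
    show _ ≤ P.real (D k)
    rw [hDdef, hlt, Finset.card_range]
    have h1 := one_add_mul_le_pow
      (show (-2 : ℝ) ≤ -tail p (k + l + 1) by linarith [tail_le_one hp_pos hp (k + l + 1)])
      (blockStart p k)
    rw [← sub_eq_add_neg] at h1
    have h2 := mul_le_mul_of_nonneg_left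
      (antitone_tail hp_pos hp (show k + 1 ≤ k + l + 1 by omega))
      (Nat.cast_nonneg (α := ℝ) (blockStart p k))
    linarith
  have hC_sum : ¬ Summable fun k => P.real (C k) := fun h => by
    refine hsum (Summable.of_norm_bounded_eventually_nat (h.mul_left 24) ?_)
    filter_upwards [eventually_block_pow_sub_pow hp_pos hp hr l hq0 hq1 hq] with k hk
    rw [Real.norm_of_nonneg (hq0 k), hPC]
    linarith
  have hmain := measure_limsup_inter_eq_one hm
    (fun i j hij => sigmaOf_mono (Set.Ici_subset_Ici.2 (monotone_blockStart hp_pos hp hij))) hCm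
    (fun k => sigmaOf_le hξ _ _ (hDI k))
    (fun k t ht => measureReal_inter_sigmaOf hξ hind
      (Set.disjoint_left.2 fun i (hi : i < _) (hi' : _ ≤ i) => by omega) (hDI k) ht) hPD
    (iIndepSet_of_sigmaOf hξ hind (pairwise_disjoint_blocks hp_pos hp) hCI) hC_sum
  refine le_antisymm prob_le_one (hmain ▸ measure_mono fun ω hω => ?_)
  have hfreq := (mem_limsup_iff_frequently_mem.1 hω).and_eventually
    (eventually_blockStop hp_pos hp hr)
  refine frequently_atTop.2 fun n₀ => ?_
  obtain ⟨k, ⟨⟨⟨hC1, hC2⟩, hDω⟩, hblock, hlt1⟩, hk⟩ := (hfreq.and_eventually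
    ((tendsto_tail p).eventually (gt_mem_nhds (show (0 : ℝ) < 1 / (n₀ + 1) by positivity)))).exists
  have hle : blockStart p k ≤ blockStop p k := hblock ▸ Nat.le_add_right _ _
  have hstart : 1 / tail p k ≤ blockStart p k := Nat.le_ceil _
  have hle' : (blockStart p k : ℝ) ≤ blockStop p k := Nat.cast_le.2 hle
  have hpos : (0 : ℝ) < blockStop p k :=
    Nat.cast_pos.2 ((one_le_blockStart hp_pos hp k).trans hle)
  -- The first `blockStop p k` variables are exactly those governed by D_k and C_k.
  refine ⟨blockStop p k, ?_, ?_⟩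
  · rw [lt_one_div (tail_pos hp_pos hp k) (by positivity)] at hk
    exact Nat.cast_le (α := ℝ).1 (by linarith)
  · rw [a_eq hp_pos hp (Nat.cast_pos.1 hpos)
      ((one_div_le hpos (tail_pos hp_pos hp k)).2 (hstart.trans hle'))
      ((lt_div_iff₀ hpos).2 (by rwa [mul_comm]))]
    have hall : ∀ i < blockStop p k, ξ i ω ≤ k + l := fun i hi => by
      rcases lt_or_ge i (blockStart p k) with h | h
      · exact Nat.lt_succ_iff.1 (mem_allLT.1 hDω i (Finset.mem_range.2 h))
      · exact Nat.lt_succ_iff.1 (mem_allLT.1 hC1 i (Finset.mem_Ico.2 ⟨h, hi⟩))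
    rw [mem_allLT] at hC2
    push Not at hC2
    obtain ⟨i, hi, hge⟩ := hC2
    exact le_antisymm (Finset.sup_le fun j hj => hall j (Finset.mem_range.1 hj))
      (hge.trans (Finset.le_sup (f := fun i => ξ i ω)
        (Finset.mem_range.2 (Finset.mem_Ico.1 hi).2)))

/-- If the ratios `tail p (k + l) / tail p (k + 1)` have a summable majorant, then the maximum
equals `a_n + l` only finitely often almost surely. -/
theorem measure_eventIO_eq_zero (hp_pos : ∀ i, 0 < p i) (hp : HasSum p 1)
    (hξ : ∀ n, Measurable (ξ n))
    (hlaw : ∀ n i, P {ω | ξ n ω = i} = ENNReal.ofReal (p i)) {l : ℕ} {q : ℕ → ℝ}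
    (hq : ∀ k, tail p (k + l) ≤ tail p (k + 1) * q k)
    (hsum : Summable q) : P (eventIO p ξ l) = 0 := by
  -- One event covers all n with a_n = k, as each is at most `blockStart p (k + 1) - 1`; the -1
  -- keeps this count below 1/T_{k+1}.
  set S : ℕ → Set Ω := fun k =>
    ⋃ i ∈ Finset.range (blockStart p (k + 1) - 1), {ω | ξ i ω ∈ Set.Iio (k + l)}ᶜ
  have hS (k : ℕ) : P (S k) ≤ ENNReal.ofReal (q k) := by
    rw [← ENNReal.ofReal_toReal (measure_ne_top P (S k))]
    refine ENNReal.ofReal_le_ofReal ?_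
    have hT := tail_pos hp_pos hp (k + 1)
    have h1 : P.real (S k) ≤ (blockStart p (k + 1) - 1 : ℕ) * tail p (k + l) := by
      refine (measureReal_biUnion_finset_le _ _).trans (le_of_eq ?_)
      have (i : ℕ) : P.real {ω | ξ i ω ∈ Set.Iio (k + l)}ᶜ = tail p (k + l) := by
        have hmeas : MeasurableSet {ω | ξ i ω ∈ Set.Iio (k + l)} := hξ i MeasurableSet.of_discrete
        rw [probReal_compl_eq_one_sub hmeas, measureReal_lt hp_pos hp hξ hlaw]
        ring
      simp only [this, Finset.sum_const, Finset.card_range, nsmul_eq_mul]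
    have h2 : ((blockStart p (k + 1) - 1 : ℕ) : ℝ) ≤ 1 / tail p (k + 1) := by
      rw [Nat.cast_pred (one_le_blockStart hp_pos hp _)]
      have := Nat.ceil_lt_add_one (one_div_pos.2 hT).le
      exact (sub_lt_iff_lt_add.2 this).le
    calc P.real (S k) ≤ (blockStart p (k + 1) - 1 : ℕ) * tail p (k + l) := h1
      _ ≤ 1 / tail p (k + 1) * (tail p (k + 1) * q k) :=
        mul_le_mul h2 (hq k) (tail_pos hp_pos hp _).le (one_div_pos.2 hT).le
      _ = q k := by field_simp
  have hfin : ∑' k, P (S k) ≠ ⊤ :=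
    ne_top_of_le_ne_top hsum.tsum_ofReal_ne_top (ENNReal.tsum_le_tsum hS)
  refine measure_mono_null (fun ω hω => ?_) (measure_limsup_atTop_eq_zero hfin)
  rw [mem_limsup_iff_frequently_mem]
  -- Since a_n → ∞, infinitely many n produce infinitely many k = a_n.
  refine (tendsto_a hp_pos hp).frequently ?_
  refine (Frequently.and_eventually (show ∃ᶠ n in atTop, _ from hω)
    (eventually_ge_atTop 1)).mono fun n ⟨hn, hn1⟩ => ?_
  obtain ⟨i, hi, heq⟩ := Finset.exists_mem_eq_sup (Finset.range n)
    (Finset.nonempty_range_iff.2 (by omega)) fun i => ξ i ω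
  have hval : ξ i ω = a p n + l := heq.symm.trans hn
  have hlt : n < blockStart p (a p n + 1) := by
    refine Nat.lt_ceil.2 ?_
    exact (lt_one_div (tail_pos hp_pos hp _) (by exact_mod_cast hn1)).1
      (tail_a_add_one_lt hp hn1)
  refine Set.mem_biUnion (Finset.mem_coe.2 (Finset.mem_range.2
    (show i < blockStart p (a p n + 1) - 1 from ?_))) ?_
  · have := Finset.mem_range.1 hi
    omega
  · simp [hval]

end Events

theorem monotoneOn_of_tendsto_atTop {f : ℕ → ℝ}
    (hmono : MonotoneOn f (Set.Ici 1) ∨ AntitoneOn f (Set.Ici 1))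
    (hlim : Tendsto f atTop atTop) : MonotoneOn f (Set.Ici 1) := by
  refine hmono.resolve_right fun h => ?_
  obtain ⟨n, hn, hn1⟩ := ((hlim.eventually_gt_atTop (f 1)).and (eventually_ge_atTop 1)).exists
  exact absurd (h (Set.mem_Ici.2 le_rfl) hn1 hn1) (not_le.2 hn)

end DiscreteMaxima

theorem theorem1 {Ω : Type*} [MeasurableSpace Ω] (P : Measure Ω) [IsProbabilityMeasure P]
    (p : ℕ → ℝ) (hp_pos : ∀ i, 0 < p i) (hp_sum : HasSum p 1)
    (ξ : ℕ → Ω → ℕ) (hξ_meas : ∀ n, Measurable (ξ n)) (hξ_indep : iIndepFun ξ P)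
    (hξ_law : ∀ n i, P {ω | ξ n ω = i} = ENNReal.ofReal (p i))
    (hr_mono : MonotoneOn (DiscreteMaxima.r p) (Set.Ici 1) ∨
      AntitoneOn (DiscreteMaxima.r p) (Set.Ici 1))
    (hr_lim : Tendsto (DiscreteMaxima.r p) atTop atTop) :
    (∀ l : ℕ, l = 0 ∨ l = 1 → P (DiscreteMaxima.eventIO p ξ l) = 1) ∧
    (∀ l : ℕ, 1 < l →
      (Summable (fun k : ℕ => Real.exp (-(((l : ℝ) - 1) * DiscreteMaxima.r p (k + 1)))) →
        P (DiscreteMaxima.eventIO p ξ l) = 0) ∧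
      (¬ Summable (fun k : ℕ => Real.exp (-(((l : ℝ) - 1) * DiscreteMaxima.r p (k + 1)))) →
        P (DiscreteMaxima.eventIO p ξ l) = 1)) := by
  have hmono := DiscreteMaxima.monotoneOn_of_tendsto_atTop hr_mono hr_lim
  refine ⟨fun l hl => ?_, fun l hl => ?_⟩
  · refine DiscreteMaxima.measure_eventIO_eq_one (q := fun _ => 1) hp_pos hp_sum hξ_meas hξ_indep
      hξ_law hr_lim l (fun _ => zero_le_one) (Eventually.of_forall fun _ => le_rfl) (fun k => ?_) ?_
    · rw [one_mul]
      exact DiscreteMaxima.antitone_tail hp_pos hp_sum (by omega)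
    · simp [summable_const_iff]
  obtain ⟨j, rfl⟩ : ∃ j, l = j + 1 := ⟨l - 1, by omega⟩
  rw [show ((j + 1 : ℕ) : ℝ) - 1 = j by push_cast; ring]
  refine ⟨fun hs => ?_, fun hs => ?_⟩
  · refine DiscreteMaxima.measure_eventIO_eq_zero
      -- The smallest of the j = l-1 increments gives the majorant; below, the largest gives the
      -- minorant.
      (q := fun k => Real.exp (-(j * DiscreteMaxima.r p (k + 2)))) hp_pos hp_sum hξ_meas
      hξ_law (fun k => ?_) ((summable_nat_add_iff 1).2 hs)
    rw [show k + (j + 1) = k + 1 + j by ring]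
    exact DiscreteMaxima.tail_add_le hp_pos hp_sum _ _ fun i hi =>
      hmono (Set.mem_Ici.2 (by omega)) (Set.mem_Ici.2 (by omega)) (by omega)
  · refine DiscreteMaxima.measure_eventIO_eq_one
      (q := fun k => Real.exp (-(j * DiscreteMaxima.r p (k + j + 1)))) hp_pos hp_sum hξ_meas
      hξ_indep hξ_law hr_lim _ (fun _ => (Real.exp_pos _).le) ?_ (fun k => ?_)
      fun h => hs ((summable_nat_add_iff j).1 h)
    · filter_upwards [((tendsto_add_atTop_iff_nat (j + 1)).2 hr_lim).eventually_ge_atTop 0] with k hk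
      rw [Real.exp_le_one_iff, neg_nonpos]
      exact mul_nonneg (Nat.cast_nonneg j) hk
    · rw [show k + (j + 1) = k + 1 + j by ring, mul_comm]
      exact DiscreteMaxima.le_tail_add hp_pos hp_sum _ _ fun i hi hi' =>
        hmono (Set.mem_Ici.2 (by omega)) (Set.mem_Ici.2 (by omega)) (by omega)
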